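/- Let $n\ge 1$, let $X_1,\dots,X_n\in\mathbb R$ be a sample with empirical measure $\mathbb P_n=\frac1n\sum_{i=1}^n\delta_{X_i}$, and let $X_{(1)}=\min_i X_i$, $X_{(n)}=\max_i X_i$. Let $\mathcal{SC}_0$ be the class of all closed, proper, concave functions $\psi:\mathbb R\to[-\infty,\infty)$ with $\psi(-x)=\psi(x)$ for all $x$ (closed means upper semicontinuous, proper means not identically $-\infty$). Call $(\hat\theta_n,\hat\psi_n)$ an MLE of the location and the log-density $(\theta_0,\psi_0)$ in the symmetric log-concave location model if $\hat\theta_n\in\mathbb R$, $\hat\psi_n\in\mathcal{SC}_0$, $\int e^{\hat\psi_n(x)}\,dx=1$, and $(\hat\theta_n,\hat\psi_n)$ maximizes the log-likelihood $\sum_{i=1}^n\psi(X_i-\theta)$ over all $\theta\in\mathbb R$ and all $\psi\in\mathcal{SC}_0$ with $\int e^{\psi(x)}\,dx=1$. Put $$\Psi_n(\theta,\psi)=\frac1n\sum_{i=1}^n\psi(X_i-\theta)-\int_{\mathbb R}e^{\psi(x-\theta)}\,dx\in[-\infty,\infty).$$ Suppose that $\mathbb P_n$ is non-degenerate, i.e.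 there is no $x_0\in\mathbb R$ with $\mathbb P_n(\{x_0\})=1$. Then: 1. The MLEs are exactly the maximizers of $\Psi_n$ over $\mathbb R\times\mathcal{SC}_0$, and an MLE $(\hat\theta_n,\hat\psi_n)$ exists. 2. If $\hat\theta_n$ is unique (all MLEs have the same location component $\hat\theta_n$), then $\hat\theta_n\in[X_{(1)},X_{(n)}]$. 3. If it is not unique, then there is at least one MLE $(\hat\theta_n,\hat\psi_n)$ with $\hat\theta_n\in[X_{(1)},X_{(n)}]$. -/

import Mathlib

open MeasureTheory
open scoped ENNReal

/-- The class `SC₀`: closed proper concave functions `ψ : ℝ → [-∞, ∞)` that are symmetric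
about the origin. A proper concave function is closed iff it is upper semicontinuous. -/
structure IsSymmClosedProperConcave (ψ : ℝ → EReal) : Prop where
  ne_top : ∀ x, ψ x ≠ ⊤
  proper : ∃ x, ψ x ≠ ⊥
  concave : ∀ x y a b : ℝ, 0 < a → 0 < b → a + b = 1 →
    (a : EReal) * ψ x + (b : EReal) * ψ y ≤ ψ (a * x + b * y)
  closed : UpperSemicontinuous ψ
  symm : ∀ x, ψ (-x) = ψ x

/-- `ψ = log g` for a symmetric log-concave probability density `g ∈ SLC₀`. -/
structure IsSymmLogConcaveLogDensity (ψ : ℝ → EReal) : Prop where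
  mem_class : IsSymmClosedProperConcave ψ
  integral_eq_one : ∫⁻ x, EReal.exp (ψ x) = 1

/-- The empirical measure `ℙₙ` of a sample `X₁, …, Xₙ`. -/
noncomputable def empiricalMeasure {n : ℕ} (X : Fin n → ℝ) : Measure ℝ :=
  (n : ℝ≥0∞)⁻¹ • ∑ i, Measure.dirac (X i)

/-- The log-likelihood `∑ᵢ log g(Xᵢ - θ)`, `ψ = log g`, with values in `[-∞, ∞)` when `ψ < ∞`. -/
noncomputable def logLikelihood {n : ℕ} (X : Fin n → ℝ) (θ : ℝ) (ψ : ℝ → EReal) : EReal :=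
  ∑ i, ψ (X i - θ)

/-- `Ψₙ(θ, ψ) = ∫ ψ(x - θ) dℙₙ(x) - ∫ exp(ψ(x - θ)) dx`, with values in `[-∞, ∞)` when `ψ < ∞`
(it is `-∞` if the last integral is infinite). -/
noncomputable def mleCriterion {n : ℕ} (X : Fin n → ℝ) (θ : ℝ) (ψ : ℝ → EReal) : EReal :=
  (((n : ℝ)⁻¹ : ℝ) : EReal) * (∑ i, ψ (X i - θ))
    - ((∫⁻ x, EReal.exp (ψ (x - θ)) : ℝ≥0∞) : EReal)

/-- `(θ, ψ)` is a maximum likelihood estimate in the symmetric log-concave location model with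
densities `x ↦ exp (ψ (x - θ))`: it maximizes the likelihood over all locations `θ' ∈ ℝ` and all
log-densities of symmetric log-concave densities. -/
def IsMLE {n : ℕ} (X : Fin n → ℝ) (θ : ℝ) (ψ : ℝ → EReal) : Prop :=
  IsSymmLogConcaveLogDensity ψ ∧
    ∀ (θ' : ℝ) (ψ' : ℝ → EReal), IsSymmLogConcaveLogDensity ψ' →
      logLikelihood X θ' ψ' ≤ logLikelihood X θ ψ

/-- `(θ, ψ) ∈ argmax Ψₙ` over `ℝ × SC₀`. -/
def IsCriterionArgmax {n : ℕ} (X : Fin n → ℝ) (θ : ℝ) (ψ : ℝ → EReal) : Prop :=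
  IsSymmClosedProperConcave ψ ∧
    ∀ (θ' : ℝ) (ψ' : ℝ → EReal), IsSymmClosedProperConcave ψ' →
      mleCriterion X θ' ψ' ≤ mleCriterion X θ ψ

/-- `θ` is the location component of some maximum likelihood estimate. -/
def IsLocationMLE {n : ℕ} (X : Fin n → ℝ) (θ : ℝ) : Prop :=
  ∃ ψ : ℝ → EReal, IsMLE X θ ψ

/-! An even concave function is nonincreasing in `|x|`. Projecting `θ` onto the sample range brings
it closer to every `X i`, so the likelihood does not drop (`logLikelihood_le_of_mem_Icc`). Hence one
MLE with location in the range settles existence and both location claims.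

Existence becomes finite-dimensional: only `θ` and lower bounds `y` for the values at the sample
matter, and `∑ y i` is maximized over `feasibleSet`. This set is closed because limiting data are
realized by their even concave hull, whose mass is at most 1 by Fatou. It is bounded because
non-degeneracy keeps some `X j` away from `θ`, so large values would force mass above 1. Mass below
1 is harmless, as normalizing only raises the likelihood.

The two maximization problems agree since adding constants to `ψ` reduces the comparison to `log c ≤
c - 1`, an equality only at `c = 1`. -/

open Filter Topology

/-! ### Even concave functions: monotonicity, mass, normalization -/

namespace IsSymmClosedProperConcave

variable {ψ : ℝ → EReal}

theorem convex_hypograph (h : IsSymmClosedProperConcave ψ) :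
    Convex ℝ {p : ℝ × ℝ | (p.2 : EReal) ≤ ψ p.1} := by
  rw [convex_iff_forall_pos]
  rintro ⟨x, p⟩ hp ⟨y, q⟩ hq a b ha hb hab
  simp only [Set.mem_ofPred_eq] at hp hq
  simp only [Prod.smul_mk, Prod.mk_add_mk, smul_eq_mul, Set.mem_ofPred_eq]
  refine le_trans ?_ (h.concave x y a b ha hb hab)
  rw [EReal.coe_add, EReal.coe_mul, EReal.coe_mul]
  exact add_le_add (mul_le_mul_of_nonneg_left hp (by exact_mod_cast ha.le))
    (mul_le_mul_of_nonneg_left hq (by exact_mod_cast hb.le))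

theorem apply_abs (h : IsSymmClosedProperConcave ψ) (x : ℝ) : ψ |x| = ψ x := by
  rcases abs_cases x with ⟨hx, -⟩ | ⟨hx, -⟩
  · rw [hx]
  · rw [hx, h.symm]

theorem coe_toReal (h : IsSymmClosedProperConcave ψ) {x : ℝ} (hx : ψ x ≠ ⊥) :
    ((ψ x).toReal : EReal) = ψ x :=
  EReal.coe_toReal (h.ne_top x) hx

/-- Superlevel sets are convex and symmetric, so one containing `z` contains `[-|z|, |z|]`. -/
theorem le_of_abs_le (h : IsSymmClosedProperConcave ψ) {x z : ℝ} (hxz : |x| ≤ |z|) :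
    ψ z ≤ ψ x := by
  by_cases hz : ψ z = ⊥
  · simp [hz]
  have hc : Convex ℝ {u : ℝ | ((ψ z).toReal : EReal) ≤ ψ u} := by
    intro u hu v hv a b ha hb hab
    have := h.convex_hypograph (x := (u, (ψ z).toReal)) hu (y := (v, (ψ z).toReal)) hv ha hb hab
    simpa [← add_mul, hab] using this
  have hmem := hc.ordConnected.out (x := -|z|) (y := |z|)
    (by simp [h.symm, h.apply_abs, h.coe_toReal hz])
    (by simp [h.apply_abs, h.coe_toReal hz]) (abs_le.mp hxz)
  simpa [h.coe_toReal hz] using hmem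

theorem le_apply_sum (h : IsSymmClosedProperConcave ψ) {ι : Type*} [Fintype ι] {w d y : ι → ℝ}
    (hw : w ∈ stdSimplex ℝ ι) (hy : ∀ i, (y i : EReal) ≤ ψ (d i)) {x : ℝ}
    (hx : |x| ≤ ∑ i, w i * d i) : ((∑ i, w i * y i : ℝ) : EReal) ≤ ψ x := by
  have := h.convex_hypograph.sum_mem (t := Finset.univ) (w := w) (z := fun i => (d i, y i))
    (fun i _ => hw.1 i) hw.2 (fun i _ => hy i)
  simp only [Set.mem_ofPred_eq, Prod.snd_sum, Prod.fst_sum, Prod.smul_snd, Prod.smul_fst,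
    smul_eq_mul] at this
  exact this.trans (h.le_of_abs_le (hx.trans (le_abs_self _)))

theorem measurable_exp (h : IsSymmClosedProperConcave ψ) : Measurable fun x => EReal.exp (ψ x) :=
  EReal.measurable_exp.comp h.closed.measurable

theorem add_const (h : IsSymmClosedProperConcave ψ) (s : ℝ) :
    IsSymmClosedProperConcave fun x => ψ x + (s : EReal) where
  ne_top x := by simpa using EReal.add_ne_top (h.ne_top x) (EReal.coe_ne_top s)
  proper := by
    obtain ⟨x, hx⟩ := h.proper
    exact ⟨x, by simp [EReal.add_eq_bot_iff, hx]⟩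
  concave x y a b ha hb hab := by
    by_cases hx : ψ x = ⊥
    · simp [hx, EReal.coe_mul_bot_of_pos ha]
    by_cases hy : ψ y = ⊥
    · simp [hy, EReal.coe_mul_bot_of_pos hb]
    refine le_trans (le_of_eq ?_) (add_le_add (h.concave x y a b ha hb hab) le_rfl)
    rw [← h.coe_toReal hx, ← h.coe_toReal hy]
    norm_cast
    linear_combination s * hab
  closed := by
    refine upperSemicontinuous_iff_isClosed_preimage.2 fun c => ?_
    have : (fun x => ψ x + (s : EReal)) ⁻¹' Set.Ici c = ψ ⁻¹' Set.Ici (c - s) := by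
      ext x
      simp only [Set.mem_preimage, Set.mem_Ici]
      exact (EReal.sub_le_iff_le_add (Or.inl (EReal.coe_ne_bot s))
        (Or.inl (EReal.coe_ne_top s))).symm
    rw [this]
    exact h.closed.isClosed_preimage _
  symm x := by simp [h.symm]

theorem lintegral_exp_add_const (h : IsSymmClosedProperConcave ψ) (s : ℝ) :
    ∫⁻ x, EReal.exp (ψ x + (s : EReal)) =
      (∫⁻ x, EReal.exp (ψ x)) * ENNReal.ofReal (Real.exp s) := by
  simp_rw [EReal.exp_add]
  rw [lintegral_mul_const _ h.measurable_exp, EReal.exp_coe]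

theorem ofReal_le_lintegral_exp (h : IsSymmClosedProperConcave ψ) {z p : ℝ}
    (hp : (p : EReal) ≤ ψ z) :
    ENNReal.ofReal (2 * |z| * Real.exp p) ≤ ∫⁻ x, EReal.exp (ψ x) := by
  calc ENNReal.ofReal (2 * |z| * Real.exp p)
      = ∫⁻ _ in Set.Icc (-|z|) |z|, EReal.exp (p : EReal) := by
        rw [setLIntegral_const, Real.volume_Icc, EReal.exp_coe,
          ENNReal.ofReal_mul (by positivity), mul_comm]
        congr 2; ring
    _ ≤ ∫⁻ x in Set.Icc (-|z|) |z|, EReal.exp (ψ x) :=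
        setLIntegral_mono h.measurable_exp fun x hx =>
          EReal.exp_monotone (hp.trans (h.le_of_abs_le (abs_le.2 hx)))
    _ ≤ _ := setLIntegral_le_lintegral _ _

/-- Subtracting the logarithm of the total mass turns a log-concave function into a density. -/
theorem normalize (h : IsSymmClosedProperConcave ψ) {c : ℝ} (hc : 0 < c)
    (hint : ∫⁻ x, EReal.exp (ψ x) = ENNReal.ofReal c) :
    IsSymmLogConcaveLogDensity fun x => ψ x + ((-Real.log c : ℝ) : EReal) where
  mem_class := h.add_const _
  integral_eq_one := by
    rw [h.lintegral_exp_add_const, hint, Real.exp_neg, Real.exp_log hc,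
      ← ENNReal.ofReal_mul hc.le, mul_inv_cancel₀ hc.ne', ENNReal.ofReal_one]

end IsSymmClosedProperConcave

/-! ### The even concave hull of finitely many points -/

/-- The least even concave function lying above the points `(dᵢ, yᵢ)`, for `dᵢ ≥ 0`. -/
noncomputable def evenConcaveHull {ι : Type*} [Fintype ι] (d y : ι → ℝ) (x : ℝ) : EReal :=
  open Classical in
  ⨆ w : stdSimplex ℝ ι, if |x| ≤ ∑ i, w.1 i * d i then ((∑ i, w.1 i * y i : ℝ) : EReal) else ⊥

section evenConcaveHull

variable {ι : Type*} [Fintype ι] {d y : ι → ℝ}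

theorem le_evenConcaveHull {w : ι → ℝ} (hw : w ∈ stdSimplex ℝ ι) {x : ℝ}
    (hx : |x| ≤ ∑ i, w i * d i) : ((∑ i, w i * y i : ℝ) : EReal) ≤ evenConcaveHull d y x := by
  classical
  refine le_trans ?_ (le_iSup _ (⟨w, hw⟩ : stdSimplex ℝ ι))
  simp [hx]

theorem le_evenConcaveHull_apply {i : ι} {x : ℝ} (hx : |x| ≤ d i) :
    (y i : EReal) ≤ evenConcaveHull d y x := by
  classical
  have := le_evenConcaveHull (d := d) (y := y) (single_mem_stdSimplex ℝ i) (x := x)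
    (by simpa [Pi.single_apply] using hx)
  simpa [Pi.single_apply] using this

/-- Joint semicontinuity over the compact simplex makes the supremum attained and, by the tube
lemma, upper semicontinuous in `x`. -/
theorem upperSemicontinuous_uncurry_hull (d y : ι → ℝ) :
    open Classical in
    UpperSemicontinuous fun p : ℝ × stdSimplex ℝ ι =>
      if |p.1| ≤ ∑ i, p.2.1 i * d i then ((∑ i, p.2.1 i * y i : ℝ) : EReal) else ⊥ := by
  classical
  have hcont : ∀ v : ι → ℝ, Continuous fun p : ℝ × stdSimplex ℝ ι => ∑ i, p.2.1 i * v i := by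
    intro v
    exact continuous_finsetSum _ fun i _ =>
      ((continuous_apply i).comp (continuous_subtype_val.comp continuous_snd)).mul continuous_const
  refine upperSemicontinuous_iff_isClosed_preimage.2 fun c => ?_
  rcases eq_bot_or_bot_lt c with rfl | hc
  · simp
  have : ((fun p : ℝ × stdSimplex ℝ ι => if |p.1| ≤ ∑ i, p.2.1 i * d i then
      ((∑ i, p.2.1 i * y i : ℝ) : EReal) else ⊥) ⁻¹' Set.Ici c) =
      {p | |p.1| ≤ ∑ i, p.2.1 i * d i} ∩ {p | c ≤ ((∑ i, p.2.1 i * y i : ℝ) : EReal)} := by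
    ext p
    simp only [Set.mem_preimage, Set.mem_Ici, Set.mem_inter_iff, Set.mem_ofPred_eq]
    split_ifs with hp
    · simp [hp]
    · simp [hp, hc.ne']
  rw [this]
  exact (isClosed_le (by fun_prop) (hcont d)).inter
    (isClosed_le continuous_const (continuous_coe_real_ereal.comp (hcont y)))

theorem exists_evenConcaveHull_eq [Nonempty ι] {x : ℝ} (hx : evenConcaveHull d y x ≠ ⊥) :
    ∃ w ∈ stdSimplex ℝ ι, |x| ≤ ∑ i, w i * d i ∧
      evenConcaveHull d y x = ((∑ i, w i * y i : ℝ) : EReal) := by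
  classical
  have husc := (upperSemicontinuous_uncurry_hull d y).comp (Continuous.prodMk_right x)
  obtain ⟨w, -, hw⟩ := (husc.upperSemicontinuousOn Set.univ).exists_isMaxOn
    (Set.univ_nonempty (α := stdSimplex ℝ ι)) isCompact_univ
  have heq : evenConcaveHull d y x =
      if |x| ≤ ∑ i, w.1 i * d i then ((∑ i, w.1 i * y i : ℝ) : EReal) else ⊥ :=
    le_antisymm (iSup_le fun v => hw (Set.mem_univ v)) (le_iSup_of_le w le_rfl)
  split_ifs at heq with hle
  · exact ⟨w.1, w.2, hle, heq⟩
  · exact absurd heq hx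

theorem upperSemicontinuous_evenConcaveHull (d y : ι → ℝ) :
    UpperSemicontinuous (evenConcaveHull d y) := by
  classical
  intro x c hxc
  obtain ⟨c', hxc', hc'⟩ := exists_between hxc
  obtain ⟨U, V, hU, -, hxU, hV, hUV⟩ := generalized_tube_lemma (isCompact_singleton (x := x))
    (isCompact_univ (X := stdSimplex ℝ ι))
    ((upperSemicontinuous_uncurry_hull d y).isOpen_preimage c') (by
      rintro ⟨x', w⟩ ⟨hx', -⟩
      obtain rfl : x' = x := hx'
      exact (le_iSup _ w).trans_lt hxc')
  filter_upwards [hU.mem_nhds (hxU rfl)] with u hu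
  exact (iSup_le fun w => (hUV (Set.mk_mem_prod hu (hV (Set.mem_univ w)))).le).trans_lt hc'

theorem isSymmClosedProperConcave_evenConcaveHull [Nonempty ι] (hd : ∀ i, 0 ≤ d i) :
    IsSymmClosedProperConcave (evenConcaveHull d y) where
  ne_top x hx := by
    obtain ⟨w, -, -, h⟩ := exists_evenConcaveHull_eq (d := d) (y := y) (x := x) (by simp [hx])
    exact EReal.coe_ne_top _ (h.symm.trans hx)
  proper := by
    obtain ⟨i⟩ := ‹Nonempty ι›
    refine ⟨0, fun h => ?_⟩
    have := le_evenConcaveHull_apply (d := d) (y := y) (i := i) (x := 0) (by simpa using hd i)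
    simp [h] at this
  concave x z a b ha hb hab := by
    by_cases hx : evenConcaveHull d y x = ⊥
    · simp [hx, EReal.coe_mul_bot_of_pos ha]
    by_cases hz : evenConcaveHull d y z = ⊥
    · simp [hz, EReal.coe_mul_bot_of_pos hb]
    obtain ⟨v, hv, hxv, hv'⟩ := exists_evenConcaveHull_eq hx
    obtain ⟨w, hw, hzw, hw'⟩ := exists_evenConcaveHull_eq hz
    have hsum : ∀ u : ι → ℝ, ∑ i, (a • v + b • w) i * u i =
        a * ∑ i, v i * u i + b * ∑ i, w i * u i := by
      intro u
      simp only [Finset.mul_sum, ← Finset.sum_add_distrib, Pi.add_apply, Pi.smul_apply, smul_eq_mul]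
      exact Finset.sum_congr rfl fun i _ => by ring
    have := le_evenConcaveHull (d := d) (y := y) (x := a * x + b * z)
      (convex_stdSimplex ℝ ι hv hw ha.le hb.le hab) (by
        rw [hsum]
        calc |a * x + b * z| ≤ |a * x| + |b * z| := abs_add_le _ _
          _ = a * |x| + b * |z| := by rw [abs_mul, abs_mul, abs_of_pos ha, abs_of_pos hb]
          _ ≤ _ := by gcongr)
    rw [hv', hw']
    rw [hsum] at this
    exact_mod_cast this
  closed := upperSemicontinuous_evenConcaveHull d y
  symm x := by simp [evenConcaveHull]

end evenConcaveHull

/-! ### Passing to the limit in the data -/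

section Limit

variable {ι : Type*} [Fintype ι] {d y : ι → ℝ} {dk yk : ℕ → ι → ℝ} {ψk : ℕ → ℝ → EReal}

/-- The constraint `|x| ≤ ∑ i, w i * d i` is stable under perturbing `d` only when strict.
Hypothesis `hx` leaves room to make it so. -/
theorem eventually_lt_of_lt_evenConcaveHull (hψ : ∀ k, IsSymmClosedProperConcave (ψk k))
    (hle : ∀ k i, (yk k i : EReal) ≤ ψk k (dk k i)) (hd : Tendsto dk atTop (𝓝 d))
    (hy : Tendsto yk atTop (𝓝 y)) {j : ι} {x : ℝ} (hx : ∀ i, |x| ≤ d i → |x| < d j)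
    {c : EReal} (hc : c < evenConcaveHull d y x) : ∀ᶠ k in atTop, c < ψk k x := by
  classical
  have : Nonempty ι := ⟨j⟩
  obtain ⟨w, hw, hxw, hT⟩ := exists_evenConcaveHull_eq (ne_bot_of_gt hc)
  rw [hT] at hc
  have hj : |x| < d j := by
    by_contra hcon
    have hlt : ∀ i, d i < |x| := fun i => not_le.1 fun h => hcon (hx i h)
    obtain ⟨i, hi⟩ : ∃ i, 0 < w i := by
      by_contra hno
      push Not at hno
      have := Finset.sum_nonpos fun i (_ : i ∈ Finset.univ) => hno i
      linarith [hw.2]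
    have : ∑ i, w i * d i < ∑ i, w i * |x| :=
      Finset.sum_lt_sum (fun i _ => mul_le_mul_of_nonneg_left (hlt i).le (hw.1 i))
        ⟨i, Finset.mem_univ i, mul_lt_mul_of_pos_left (hlt i) hi⟩
    rw [← Finset.sum_mul, hw.2, one_mul] at this
    linarith
  -- Tilt the optimal weights slightly towards `j`: the constraint becomes strict, and the value
  -- stays above `c` for small `t`.
  set v : ℝ → ι → ℝ := fun t => (1 - t) • w + t • Pi.single j (1 : ℝ)
  have hsum : ∀ t (u : ι → ℝ), ∑ i, v t i * u i = (1 - t) * ∑ i, w i * u i + t * u j := by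
    intro t u
    simp only [v, Pi.add_apply, Pi.smul_apply, smul_eq_mul, add_mul, Finset.sum_add_distrib,
      mul_assoc, ← Finset.mul_sum]
    simp [Pi.single_apply]
  have hlim : Tendsto (fun t : ℝ => ((∑ i, v t i * y i : ℝ) : EReal)) (𝓝[>] 0)
      (𝓝 ((∑ i, w i * y i : ℝ) : EReal)) := by
    refine (continuous_coe_real_ereal.tendsto _).comp ?_
    simp_rw [hsum]
    have : Continuous fun t : ℝ => (1 - t) * ∑ i, w i * y i + t * y j := by fun_prop
    have h0 := this.tendsto 0
    simp only [sub_zero, one_mul, zero_mul, add_zero] at h0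
    exact h0.mono_left nhdsWithin_le_nhds
  obtain ⟨t, htc, ht0, ht1⟩ := ((hlim.eventually (lt_mem_nhds hc)).and
    (Ioo_mem_nhdsGT (zero_lt_one (α := ℝ)))).exists
  have hvt : v t ∈ stdSimplex ℝ ι := convex_stdSimplex ℝ ι hw (single_mem_stdSimplex ℝ j)
    (by linarith) ht0.le (by ring)
  have hdt : |x| < ∑ i, v t i * d i := by
    rw [hsum]
    nlinarith
  have htend : ∀ {uk : ℕ → ι → ℝ} {u : ι → ℝ}, Tendsto uk atTop (𝓝 u) →
      Tendsto (fun k => ∑ i, v t i * uk k i) atTop (𝓝 (∑ i, v t i * u i)) := fun hu =>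
    tendsto_finsetSum _ fun i _ => (tendsto_pi_nhds.1 hu i).const_mul _
  filter_upwards [(htend hd).eventually (lt_mem_nhds hdt),
    ((continuous_coe_real_ereal.tendsto _).comp (htend hy)).eventually (lt_mem_nhds htc)]
    with k hk1 hk2
  exact lt_of_lt_of_le hk2 ((hψ k).le_apply_sum hvt (hle k) hk1.le)

theorem lintegral_exp_evenConcaveHull_le [Nonempty ι]
    (hψ : ∀ k, IsSymmClosedProperConcave (ψk k)) (hint : ∀ k, ∫⁻ x, EReal.exp (ψk k x) ≤ 1)
    (hle : ∀ k i, (yk k i : EReal) ≤ ψk k (dk k i)) (hd : Tendsto dk atTop (𝓝 d))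
    (hy : Tendsto yk atTop (𝓝 y)) : ∫⁻ x, EReal.exp (evenConcaveHull d y x) ≤ 1 := by
  obtain ⟨j, hj⟩ := Finite.exists_max d
  have hae : ∀ᵐ x : ℝ, EReal.exp (evenConcaveHull d y x) ≤
      liminf (fun k => EReal.exp (ψk k x)) atTop := by
    -- The pointwise bound can fail only at the endpoints `±d j` of the hull's domain, a null set.
    have h1 : ∀ᵐ x : ℝ, x ≠ d j := by simp [ae_iff]
    have h2 : ∀ᵐ x : ℝ, x ≠ -d j := by simp [ae_iff]
    filter_upwards [h1, h2] with x hx1 hx2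
    refine (le_liminf_iff).2 fun c hc => ?_
    have hc' : ENNReal.log c < evenConcaveHull d y x := by
      rwa [← EReal.exp_lt_exp_iff, ENNReal.exp_log]
    filter_upwards [eventually_lt_of_lt_evenConcaveHull hψ hle hd hy (j := j) (fun i hi =>
      lt_of_le_of_ne (hi.trans (hj i)) fun h => by
        rcases abs_cases x with ⟨h', -⟩ | ⟨h', -⟩
        · exact hx1 (h' ▸ h)
        · exact hx2 (by linarith)) hc'] with k hk
    rwa [← EReal.exp_lt_exp_iff, ENNReal.exp_log] at hk
  calc ∫⁻ x, EReal.exp (evenConcaveHull d y x)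
      ≤ ∫⁻ x, liminf (fun k => EReal.exp (ψk k x)) atTop := lintegral_mono_ae hae
    _ ≤ liminf (fun k => ∫⁻ x, EReal.exp (ψk k x)) atTop :=
        lintegral_liminf_le fun k => (hψ k).measurable_exp
    _ ≤ 1 := by
        refine liminf_le_of_frequently_le' (Frequently.of_forall hint)

end Limit

/-! ### Compactness of the feasible set -/

/-- Locations in `[m, M]` together with real lower bounds, of sum at least `L`, for the values at
the sample of a symmetric log-concave sub-probability log-density at that location. -/
def feasibleSet {n : ℕ} (X : Fin n → ℝ) (m M L : ℝ) : Set (ℝ × (Fin n → ℝ)) :=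
  {p | p.1 ∈ Set.Icc m M ∧ L ≤ ∑ i, p.2 i ∧ ∃ ψ : ℝ → EReal, IsSymmClosedProperConcave ψ ∧
    ∫⁻ x, EReal.exp (ψ x) ≤ 1 ∧ ∀ i, (p.2 i : EReal) ≤ ψ (X i - p.1)}

section feasibleSet

variable {n : ℕ} {X : Fin n → ℝ} {m M L : ℝ}

theorem isClosed_feasibleSet [Nonempty (Fin n)] : IsClosed (feasibleSet X m M L) := by
  refine IsSeqClosed.isClosed fun p q hp hpq => ?_
  have h1 : Tendsto (fun k => (p k).1) atTop (𝓝 q.1) := (continuous_fst.tendsto _).comp hpq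
  have h2 : Tendsto (fun k => (p k).2) atTop (𝓝 q.2) := (continuous_snd.tendsto _).comp hpq
  choose hm hL ψ hψ hint hle using hp
  refine ⟨isClosed_Icc.mem_of_tendsto h1 (Eventually.of_forall hm),
    ge_of_tendsto (tendsto_finsetSum _ fun i _ => tendsto_pi_nhds.1 h2 i)
      (Eventually.of_forall hL),
    evenConcaveHull (fun i => |X i - q.1|) q.2,
    isSymmClosedProperConcave_evenConcaveHull fun i => abs_nonneg _,
    lintegral_exp_evenConcaveHull_le (dk := fun k i => |X i - (p k).1|) hψ hint
      (fun k i => by rw [(hψ k).apply_abs]; exact hle k i) ?_ h2,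
    fun i => le_evenConcaveHull_apply le_rfl⟩
  exact tendsto_pi_nhds.2 fun i => (h1.const_sub _).abs

theorem exists_half_dist_le_abs_sub (a b θ : ℝ) : |a - b| / 2 ≤ |a - θ| ∨ |a - b| / 2 ≤ |b - θ| := by
  by_contra! h
  have := abs_sub_le a θ b
  rw [abs_sub_comm θ b] at this
  linarith

/-- The peak `A = ψ 0` bounds every `y i` above, and the sum constraint then bounds each below by `L
- (n - 1) * A`. Concavity between `0` and a sample point at distance at least `r` from `θ` puts a
rectangle under `exp ψ`, and its area, at most 1, bounds `A`. -/
theorem exists_bound_of_mem_feasibleSet {a b : Fin n} (hab : X a ≠ X b) :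
    ∃ C : ℝ, ∀ p ∈ feasibleSet X m M L, ∀ i, L - (n - 1) * C ≤ p.2 i ∧ p.2 i ≤ C := by
  have hn : (1 : ℝ) ≤ n := by exact_mod_cast a.pos
  set r : ℝ := |X a - X b| / 2 with hr
  have hr0 : 0 < r := half_pos (abs_pos.2 (sub_ne_zero.2 hab))
  -- At `t * r` concavity gives at least `(1 - t * n) * A + t * L`; this `t` makes the coefficient
  -- of `A` equal to `1 / 2`.
  set t : ℝ := 1 / (2 * n) with ht
  have ht0 : 0 < t := by positivity
  have htn : t * n = 1 / 2 := by rw [ht]; field_simp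
  have ht1 : t ≤ 1 := by nlinarith
  set C : ℝ := 2 * (-Real.log (2 * (t * r)) - t * L) with hC
  refine ⟨C, ?_⟩
  rintro ⟨θ, y⟩ ⟨-, hL, ψ, hψ, hint, hle⟩
  simp only at hL hle ⊢
  have hz : ψ 0 ≠ ⊥ := by
    intro h
    have := (hle a).trans (hψ.le_of_abs_le (x := 0) (by simp))
    simp [h] at this
  set A : ℝ := (ψ 0).toReal with hA
  have hA' : (A : EReal) = ψ 0 := hψ.coe_toReal hz
  have hyA : ∀ i, y i ≤ A := fun i => by
    have := (hle i).trans (hψ.le_of_abs_le (x := 0) (by simp))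
    rw [← hA'] at this
    exact_mod_cast this
  have hlow : ∀ j, L - (n - 1) * A ≤ y j := fun j => by
    have h1 := Finset.sum_erase_add Finset.univ y (Finset.mem_univ j)
    have h2 : ∑ i ∈ Finset.univ.erase j, y i ≤ (n - 1) * A := by
      have := Finset.sum_le_card_nsmul (Finset.univ.erase j) y A fun i _ => hyA i
      rw [Finset.card_erase_of_mem (Finset.mem_univ j), Finset.card_univ, Fintype.card_fin,
        nsmul_eq_mul, Nat.cast_sub a.pos] at this
      simpa using this
    linarith
  obtain ⟨j, hj⟩ : ∃ j, r ≤ |X j - θ| := by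
    rcases exists_half_dist_le_abs_sub (X a) (X b) θ with h | h
    exacts [⟨a, h⟩, ⟨b, h⟩]
  have hyr : (y j : EReal) ≤ ψ r :=
    (hle j).trans (hψ.le_of_abs_le (by rwa [abs_of_pos hr0]))
  have hconv := hψ.convex_hypograph (x := (0, A)) hA'.le (y := (r, y j)) hyr
    (sub_nonneg.2 ht1) ht0.le (by ring)
  simp only [Prod.smul_mk, smul_eq_mul, mul_zero, Prod.mk_add_mk, zero_add,
    Set.mem_ofPred_eq] at hconv
  have hmass := (hψ.ofReal_le_lintegral_exp hconv).trans hint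
  rw [ENNReal.ofReal_le_one, abs_of_pos (by positivity)] at hmass
  have hlog : (1 - t) * A + t * y j ≤ -Real.log (2 * (t * r)) := by
    rw [← Real.log_inv, Real.le_log_iff_exp_le (by positivity), le_inv_comm₀ (by positivity)
      (by positivity)]
    rw [← one_div, le_div_iff₀ (by positivity)]
    exact hmass
  have hAC : A ≤ C := by
    have := mul_le_mul_of_nonneg_left (hlow j) ht0.le
    have h3 : t * (L - (n - 1) * A) = t * L - 1 / 2 * A + t * A := by rw [← htn]; ring
    rw [hC]
    linarith
  refine fun i => ⟨le_trans ?_ (hlow i), (hyA i).trans hAC⟩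
  have := mul_le_mul_of_nonneg_left hAC (sub_nonneg.2 hn)
  linarith

theorem isCompact_feasibleSet {a b : Fin n} (hab : X a ≠ X b) :
    IsCompact (feasibleSet X m M L) := by
  have : Nonempty (Fin n) := ⟨a⟩
  obtain ⟨C, hC⟩ := exists_bound_of_mem_feasibleSet (m := m) (M := M) (L := L) hab
  refine ((isCompact_Icc (a := m) (b := M)).prod (isCompact_univ_pi fun _ : Fin n =>
    isCompact_Icc (a := L - (n - 1) * C) (b := C))).of_isClosed_subset isClosed_feasibleSet ?_
  exact fun p hp => ⟨hp.1, fun i _ => hC p hp i⟩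

end feasibleSet

theorem EReal.coe_finsetSum {ι : Type*} (s : Finset ι) (y : ι → ℝ) :
    ((∑ i ∈ s, y i : ℝ) : EReal) = ∑ i ∈ s, (y i : EReal) :=
  map_sum (⟨⟨Real.toEReal, EReal.coe_zero⟩, EReal.coe_add⟩ : ℝ →+ EReal) y s

/-! ### Likelihood, existence of the MLE, and the criterion -/

section likelihood

variable {n : ℕ} {X : Fin n → ℝ} {θ : ℝ} {ψ : ℝ → EReal}

theorem logLikelihood_eq_coe_sum {y : Fin n → ℝ} (hy : ∀ i, (y i : EReal) = ψ (X i - θ)) :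
    logLikelihood X θ ψ = ((∑ i, y i : ℝ) : EReal) := by
  simp only [logLikelihood, ← hy, EReal.coe_finsetSum]

theorem exists_coe_eq_of_logLikelihood_ne_bot (hψ : IsSymmClosedProperConcave ψ)
    (h : logLikelihood X θ ψ ≠ ⊥) : ∃ y : Fin n → ℝ, ∀ i, (y i : EReal) = ψ (X i - θ) := by
  refine ⟨fun i => (ψ (X i - θ)).toReal, fun i => hψ.coe_toReal fun hi => h ?_⟩
  rw [logLikelihood, ← Finset.add_sum_erase _ _ (Finset.mem_univ i), hi, EReal.bot_add]

theorem logLikelihood_add_const {y : Fin n → ℝ} (hy : ∀ i, (y i : EReal) = ψ (X i - θ)) (s : ℝ) :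
    logLikelihood X θ (fun x => ψ x + (s : EReal)) = ((∑ i, y i + n * s : ℝ) : EReal) := by
  rw [logLikelihood_eq_coe_sum (y := fun i => y i + s) fun i => by rw [EReal.coe_add, hy],
    Finset.sum_add_distrib]
  simp

theorem lintegral_exp_pos (hψ : IsSymmClosedProperConcave ψ) {a b : Fin n} (hab : X a ≠ X b)
    {y : Fin n → ℝ} (hy : ∀ i, (y i : EReal) ≤ ψ (X i - θ)) : 0 < ∫⁻ x, EReal.exp (ψ x) := by
  obtain ⟨j, hj⟩ : ∃ j, |X a - X b| / 2 ≤ |X j - θ| := by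
    rcases exists_half_dist_le_abs_sub (X a) (X b) θ with h | h
    exacts [⟨a, h⟩, ⟨b, h⟩]
  have hpos : 0 < |X j - θ| := (half_pos (abs_pos.2 (sub_ne_zero.2 hab))).trans_le hj
  refine lt_of_lt_of_le ?_ (hψ.ofReal_le_lintegral_exp (hy j))
  exact ENNReal.ofReal_pos.2 (by positivity)

theorem logLikelihood_le_of_mem_Icc (hψ : IsSymmClosedProperConcave ψ) {m M : ℝ}
    (hX : ∀ i, X i ∈ Set.Icc m M) (hmM : m ≤ M) (θ : ℝ) :
    logLikelihood X θ ψ ≤ logLikelihood X (Set.projIcc m M hmM θ) ψ := by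
  refine Finset.sum_le_sum fun i _ => hψ.le_of_abs_le ?_
  obtain ⟨h1, h2⟩ := hX i
  rcases le_total θ m with h | h
  · rw [Set.projIcc_of_le_left _ h]
    simp only
    rw [abs_of_nonneg (by linarith), abs_of_nonneg (by linarith)]
    linarith
  rcases le_total M θ with h' | h'
  · rw [Set.projIcc_of_right_le _ h']
    simp only
    rw [abs_of_nonpos (by linarith), abs_of_nonpos (by linarith)]
    linarith
  · rw [Set.projIcc_of_mem hmM ⟨h, h'⟩]

theorem exists_density_logLikelihood_ne_bot {a b : Fin n} (hab : X a ≠ X b) (θ : ℝ) :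
    ∃ ψ, IsSymmLogConcaveLogDensity ψ ∧ logLikelihood X θ ψ ≠ ⊥ := by
  have : Nonempty (Fin n) := ⟨a⟩
  set d : Fin n → ℝ := fun i => |X i - θ| with hd
  -- With zero heights, `exp φ` is the indicator of a symmetric interval reaching all `X i - θ`;
  -- normalized, it is a uniform density.
  set φ := evenConcaveHull d 0 with hφ
  have hclass : IsSymmClosedProperConcave φ :=
    isSymmClosedProperConcave_evenConcaveHull fun i => abs_nonneg _
  have hzero : ∀ {x}, φ x ≠ ⊥ → φ x = 0 ∧ |x| ≤ ∑ i, d i := by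
    intro x hx
    obtain ⟨w, hw, hle, h⟩ := exists_evenConcaveHull_eq hx
    refine ⟨by simpa using h, hle.trans (Finset.sum_le_sum fun i _ => ?_)⟩
    exact mul_le_of_le_one_left (abs_nonneg _) (mem_Icc_of_mem_stdSimplex hw i).2
  have hy : ∀ i, (((0 : Fin n → ℝ) i : ℝ) : EReal) = φ (X i - θ) := by
    intro i
    have h : (((0 : Fin n → ℝ) i : ℝ) : EReal) ≤ φ (X i - θ) := le_evenConcaveHull_apply le_rfl
    refine (hzero fun hb => ?_).1.symm
    simp [hb] at h
  have hfin : ∫⁻ x, EReal.exp (φ x) ≠ ⊤ := by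
    refine ne_top_of_le_ne_top ?_ (lintegral_mono (g := (Set.Icc (-∑ i, d i) (∑ i, d i)).indicator
      fun _ => (1 : ℝ≥0∞)) fun x => ?_)
    · rw [lintegral_indicator measurableSet_Icc]
      simp
    · by_cases hx : φ x = ⊥
      · simp [hx]
      · obtain ⟨h0, hle⟩ := hzero hx
        simp [h0, Set.indicator_of_mem (Set.mem_Icc.2 (abs_le.1 hle))]
  have hpos := lintegral_exp_pos hclass hab fun i => (hy i).le
  refine ⟨_, hclass.normalize (ENNReal.toReal_pos hpos.ne' hfin) (ENNReal.ofReal_toReal hfin).symm,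
    ?_⟩
  rw [logLikelihood_add_const hy]
  exact EReal.coe_ne_bot _

theorem exists_isMLE_mem_Icc {a b : Fin n} (hab : X a ≠ X b) {m M : ℝ}
    (hX : ∀ i, X i ∈ Set.Icc m M) : ∃ θ ∈ Set.Icc m M, ∃ ψ, IsMLE X θ ψ := by
  have hmM : m ≤ M := (hX a).1.trans (hX a).2
  obtain ⟨ψ₀, hψ₀, hne⟩ := exists_density_logLikelihood_ne_bot hab m
  obtain ⟨y₀, hy₀⟩ := exists_coe_eq_of_logLikelihood_ne_bot hψ₀.mem_class hne
  obtain ⟨⟨θ, y⟩, ⟨hθ, hL, φ, hφ, hint, hle⟩, hmax⟩ :=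
    (isCompact_feasibleSet (m := m) (M := M) (L := ∑ i, y₀ i) hab).exists_isMaxOn
      ⟨(m, y₀), Set.left_mem_Icc.2 hmM, le_rfl, ψ₀, hψ₀.mem_class, hψ₀.integral_eq_one.le,
        fun i => (hy₀ i).le⟩
      (f := fun p : ℝ × (Fin n → ℝ) => ∑ i, p.2 i) (by fun_prop)
  have hpos := lintegral_exp_pos hφ hab hle
  have hfin := ne_top_of_le_ne_top ENNReal.one_ne_top hint
  set c := (∫⁻ x, EReal.exp (φ x)).toReal
  have hc : 0 < c := ENNReal.toReal_pos hpos.ne' hfin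
  have hc1 : c ≤ 1 := ENNReal.toReal_le_of_le_ofReal zero_le_one (by simpa using hint)
  refine ⟨θ, hθ, _, hφ.normalize hc (ENNReal.ofReal_toReal hfin).symm, fun θ' ψ' hψ' => ?_⟩
  have hge : ((∑ i, y i : ℝ) : EReal) ≤
      logLikelihood X θ fun x => φ x + ((-Real.log c : ℝ) : EReal) := by
    rw [EReal.coe_finsetSum]
    refine Finset.sum_le_sum fun i _ => ?_
    have h0 : (0 : EReal) ≤ ((-Real.log c : ℝ) : EReal) := by
      exact_mod_cast neg_nonneg.2 (Real.log_nonpos hc.le hc1)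
    simpa using (hle i).trans (le_add_of_nonneg_right h0)
  refine le_trans ?_ hge
  refine (logLikelihood_le_of_mem_Icc hψ'.mem_class hX hmM θ').trans ?_
  set θ'' : ℝ := (Set.projIcc m M hmM θ').1
  by_cases hb : logLikelihood X θ'' ψ' = ⊥
  · simp [hb]
  obtain ⟨y', hy'⟩ := exists_coe_eq_of_logLikelihood_ne_bot hψ'.mem_class hb
  rw [logLikelihood_eq_coe_sum hy']
  rw [EReal.coe_le_coe_iff]
  -- Competitors below the threshold `∑ i, y₀ i` are infeasible, but lose to the maximizer by its
  -- own sum constraint.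
  rcases le_total (∑ i, y₀ i) (∑ i, y' i) with h | h
  · exact hmax (a := (θ'', y')) ⟨(Set.projIcc m M hmM θ').2, h, ψ', hψ'.mem_class,
      hψ'.integral_eq_one.le, fun i => (hy' i).le⟩
  · exact h.trans hL

theorem mleCriterion_eq (X : Fin n → ℝ) (θ : ℝ) (ψ : ℝ → EReal) :
    mleCriterion X θ ψ = (((n : ℝ)⁻¹ : ℝ) : EReal) * logLikelihood X θ ψ -
      ((∫⁻ x, EReal.exp (ψ x) : ℝ≥0∞) : EReal) := by
  rw [mleCriterion, logLikelihood, lintegral_sub_right_eq_self fun x => EReal.exp (ψ x)]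

theorem mleCriterion_eq_coe {y : Fin n → ℝ} (hy : ∀ i, (y i : EReal) = ψ (X i - θ)) {c : ℝ}
    (hc : 0 ≤ c) (hint : ∫⁻ x, EReal.exp (ψ x) = ENNReal.ofReal c) :
    mleCriterion X θ ψ = (((n : ℝ)⁻¹ * ∑ i, y i - c : ℝ) : EReal) := by
  rw [mleCriterion_eq, logLikelihood_eq_coe_sum hy, hint, EReal.coe_ennreal_ofReal, max_eq_left hc]
  norm_cast

/-- A finite criterion means a finite likelihood and a positive finite total mass. -/
theorem exists_coe_eq_of_mleCriterion_ne_bot (hψ : IsSymmClosedProperConcave ψ)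
    {a b : Fin n} (hab : X a ≠ X b) (h : mleCriterion X θ ψ ≠ ⊥) :
    ∃ y : Fin n → ℝ, ∃ c : ℝ, (∀ i, (y i : EReal) = ψ (X i - θ)) ∧ 0 < c ∧
      ∫⁻ x, EReal.exp (ψ x) = ENNReal.ofReal c := by
  have hn : (0 : ℝ) < (n : ℝ)⁻¹ := inv_pos.2 (by exact_mod_cast a.pos)
  rw [mleCriterion_eq] at h
  obtain ⟨y, hy⟩ := exists_coe_eq_of_logLikelihood_ne_bot (X := X) (θ := θ) hψ fun hb => h (by
    rw [hb, EReal.coe_mul_bot_of_pos hn, EReal.bot_sub])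
  have hfin : ∫⁻ x, EReal.exp (ψ x) ≠ ⊤ := fun ht => h (by
    rw [ht, EReal.coe_ennreal_top, EReal.sub_top])
  exact ⟨y, _, hy, ENNReal.toReal_pos (lintegral_exp_pos hψ hab fun i => (hy i).le).ne' hfin,
    (ENNReal.ofReal_toReal hfin).symm⟩

theorem isMLE_iff_isCriterionArgmax {a b : Fin n} (hab : X a ≠ X b) :
    IsMLE X θ ψ ↔ IsCriterionArgmax X θ ψ := by
  have hn : (0 : ℝ) < n := by exact_mod_cast a.pos
  have hn' : (0 : ℝ) < (n : ℝ)⁻¹ := inv_pos.2 hn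
  have hone : (1 : ℝ≥0∞) = ENNReal.ofReal 1 := ENNReal.ofReal_one.symm
  have hscale : ∀ s t : ℝ, (n : ℝ)⁻¹ * (s + n * t) = (n : ℝ)⁻¹ * s + t := fun s t => by
    field_simp
  obtain ⟨ψ₀, hψ₀, hne⟩ := exists_density_logLikelihood_ne_bot hab θ
  constructor
  · rintro ⟨hψ, hmax⟩
    obtain ⟨y, hy⟩ := exists_coe_eq_of_logLikelihood_ne_bot (X := X) (θ := θ) hψ.mem_class
      (ne_bot_of_le_ne_bot hne (hmax θ ψ₀ hψ₀))
    refine ⟨hψ.mem_class, fun θ' ψ' hψ' => ?_⟩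
    by_cases hb : mleCriterion X θ' ψ' = ⊥
    · simp [hb]
    obtain ⟨y', c, hy', hc, hint⟩ := exists_coe_eq_of_mleCriterion_ne_bot hψ' hab hb
    have hlik := hmax θ' _ (hψ'.normalize hc hint)
    rw [logLikelihood_add_const hy', logLikelihood_eq_coe_sum hy, EReal.coe_le_coe_iff] at hlik
    rw [mleCriterion_eq_coe hy' hc.le hint,
      mleCriterion_eq_coe hy zero_le_one (hψ.integral_eq_one.trans hone), EReal.coe_le_coe_iff]
    have h1 := mul_le_mul_of_nonneg_left hlik hn'.le
    rw [hscale] at h1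
    linarith [Real.log_le_sub_one_of_pos hc]
  · rintro ⟨hψ, hmax⟩
    have hfinite : ∀ {θ' ψ'}, IsSymmLogConcaveLogDensity ψ' → logLikelihood X θ' ψ' ≠ ⊥ →
        mleCriterion X θ' ψ' ≠ ⊥ := by
      intro θ' ψ' hψ' h
      obtain ⟨y', hy'⟩ := exists_coe_eq_of_logLikelihood_ne_bot hψ'.mem_class h
      rw [mleCriterion_eq_coe hy' zero_le_one (hψ'.integral_eq_one.trans hone)]
      exact EReal.coe_ne_bot _
    obtain ⟨y, c, hy, hc, hint⟩ := exists_coe_eq_of_mleCriterion_ne_bot (X := X) (θ := θ) hψ hab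
      (ne_bot_of_le_ne_bot (hfinite hψ₀ hne) (hmax θ ψ₀ hψ₀.mem_class))
    -- Normalizing changes the criterion by `c - 1 - log c`, which is positive unless `c = 1`.
    obtain rfl : c = 1 := by
      have hdens := hψ.normalize hc hint
      have h := hmax θ _ hdens.mem_class
      rw [mleCriterion_eq_coe (y := fun i => y i + -Real.log c) (fun i => by
          rw [EReal.coe_add, hy]) zero_le_one (hdens.integral_eq_one.trans hone),
        mleCriterion_eq_coe hy hc.le hint, EReal.coe_le_coe_iff, Finset.sum_add_distrib,
        Finset.sum_const, Finset.card_univ, Fintype.card_fin, nsmul_eq_mul, hscale] at h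
      by_contra hc1
      linarith [Real.log_lt_sub_one_of_pos hc hc1]
    refine ⟨⟨hψ, hint.trans hone.symm⟩, fun θ' ψ' hψ' => ?_⟩
    by_cases hb : logLikelihood X θ' ψ' = ⊥
    · simp [hb]
    obtain ⟨y', hy'⟩ := exists_coe_eq_of_logLikelihood_ne_bot hψ'.mem_class hb
    have h := hmax θ' ψ' hψ'.mem_class
    rw [mleCriterion_eq_coe hy' zero_le_one (hψ'.integral_eq_one.trans hone),
      mleCriterion_eq_coe hy zero_le_one hint, EReal.coe_le_coe_iff, sub_le_sub_iff_right,
      mul_le_mul_iff_right₀ hn'] at h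
    rw [logLikelihood_eq_coe_sum hy', logLikelihood_eq_coe_sum hy]
    exact_mod_cast h

theorem exists_ne_of_empiricalMeasure_ne_one (hn : 0 < n)
    (hX : ¬ ∃ x₀ : ℝ, empiricalMeasure X {x₀} = 1) : ∃ a b, X a ≠ X b := by
  by_contra! h
  refine hX ⟨X ⟨0, hn⟩, ?_⟩
  have : ∀ i, X i = X ⟨0, hn⟩ := fun i => h _ _
  simp only [empiricalMeasure, Measure.smul_apply, Measure.finsetSum_apply, smul_eq_mul, this]
  simp [ENNReal.inv_mul_cancel, hn.ne']

end likelihood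

theorem theorem3 {n : ℕ} (hn : 0 < n) (X : Fin n → ℝ)
    (hX : ¬ ∃ x₀ : ℝ, empiricalMeasure X {x₀} = 1) :
    (∀ (θ : ℝ) (ψ : ℝ → EReal), IsMLE X θ ψ ↔ IsCriterionArgmax X θ ψ) ∧
    (∃ (θ : ℝ) (ψ : ℝ → EReal), IsMLE X θ ψ) ∧
    (∀ θ : ℝ, IsLocationMLE X θ → (∀ θ' : ℝ, IsLocationMLE X θ' → θ' = θ) →
      θ ∈ Set.Icc (⨅ i, X i) (⨆ i, X i)) ∧
    (¬ (∃! θ : ℝ, IsLocationMLE X θ) →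
      ∃ θ ∈ Set.Icc (⨅ i, X i) (⨆ i, X i), IsLocationMLE X θ) := by
  obtain ⟨a, b, hab⟩ := exists_ne_of_empiricalMeasure_ne_one hn hX
  obtain ⟨θ₀, hθ₀, hMLE⟩ := exists_isMLE_mem_Icc hab fun i =>
    (⟨ciInf_le (Set.finite_range X).bddBelow i, le_ciSup (Set.finite_range X).bddAbove i⟩ :
      X i ∈ Set.Icc (⨅ i, X i) (⨆ i, X i))
  refine ⟨fun θ ψ => isMLE_iff_isCriterionArgmax hab, ⟨θ₀, hMLE⟩, fun θ _ huniq => ?_,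
    fun _ => ⟨θ₀, hθ₀, hMLE⟩⟩
  exact huniq θ₀ hMLE ▸ hθ₀
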